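/- Let $\lambda\ge 2$ be an integer, let $N$ be a nonnegative integer, and let $X=(x_{ij})$ be an $N\times N$ matrix over $\mathbb R$ or $\mathbb C$, or more generally over any commutative $\mathbb R$-algebra $R$ (for instance the matrix of indeterminates $x_{ij}$). Then the following identity holds in the ring $R[[t]]$ of formal power series in the indeterminate $t$: $$\sum_{p=0}^{\infty}\frac{p+1}{\lambda-1}\sum_{\sigma}t^{\,p+\sum_{j=2}^N j\sigma_j}\,C^{\lambda}_{p,\sigma}\,\widehat T(X)^{\sigma}\sum_{\alpha\vdash p}\mathcal D^{p}_{\alpha\alpha}(X)=\det(I-tX)^{-\lambda}.$$ Here $\sigma=(\sigma_2,\dots,\sigma_N)$ runs over all $(N-1)$-tuples of nonnegative integers (only the empty tuple if $N\le 1$), and $\det(I-tX)$ is invertible in $R[[t]]$. The notation is as follows. * $\alpha\vdash p$ means that $\alpha=(\alpha_1,\dots,\alpha_N)$ is a sequence of nonnegative integers with $\alpha_1+\dots+\alpha_N=p$. For $\alpha,\beta\vdash p$ the $SU(N)$ solid harmonics are $$\mathcal D^p_{\alpha\beta}(X)=\sqrt{\alpha!\,\beta!}\sum_{A}\prod_{i,j=1}^N\frac{x_{ij}^{a_{ij}}}{a_{ij}!},\qquad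 \alpha!=\prod_{i=1}^N\alpha_i!,$$ where $A=(a_{ij})$ runs over the $N\times N$ matrices of nonnegative integers whose $i$-th row sums to $\alpha_i$ and whose $j$-th column sums to $\beta_j$ for all $i,j$. * $T_q(X)$ is the sum of all $q\times q$ principal minors of $X$, $\widehat T_q(X)=(-1)^q(q-1)T_q(X)$, and $\widehat T(X)^\sigma=\widehat T_2(X)^{\sigma_2}\cdots\widehat T_N(X)^{\sigma_N}$. * For a multi-index $\gamma=(\gamma_2,\dots,\gamma_N)$ write $|\gamma|=\sum_{j=2}^N\gamma_j$ and $\binom{|\gamma|}{\gamma}=\frac{|\gamma|!}{\gamma_2!\cdots\gamma_N!}$. Then $$C^\lambda_{p,\sigma}=\frac1{(\lambda-2)!}\sum_{\gamma^{(0)}=0}^{\sigma}\ \sum_{\gamma^{(1)}=0}^{\sigma-\gamma^{(0)}}\cdots\sum_{\gamma^{(\lambda-3)}=0}^{\sigma-\gamma^{(0)}-\cdots-\gamma^{(\lambda-4)}}\binom{|\sigma-\sum_{i=0}^{\lambda-3}\gamma^{(i)}|}{\sigma-\sum_{i=0}^{\lambda-3}\gamma^{(i)}}\prod_{k=0}^{\lambda-3}\binom{|\gamma^{(k)}|}{\gamma^{(k)}}\Bigl(p+k+2+\sum_{j=2}^N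 j\sum_{i=0}^k\gamma^{(i)}_j\Bigr),$$ where the sums over multi-indices are componentwise. For $\lambda=2$ there is no summation variable and $C^2_{p,\sigma}=\binom{|\sigma|}{\sigma}$. -/

import Mathlib

open Finset
open scoped Nat PowerSeries PowerSeries.WithPiTopology

noncomputable section

namespace MSMT

/-- `𝕄_N(α, β)`: the `N × N` matrices of nonnegative integers whose entries in row `i` sum to
`α i` and whose entries in column `j` sum to `β j`. -/
def contingency {N : ℕ} (α β : Fin N → ℕ) : Finset (Fin N → Fin N → ℕ) :=
  {A ∈ Fintype.piFinset fun i => Finset.piAntidiag Finset.univ (α i) | ∀ j, ∑ i, A i j = β j}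

/-- Sanity check for `contingency`: membership is exactly the two families of sum conditions. -/
theorem mem_contingency {N : ℕ} (α β : Fin N → ℕ) (A : Fin N → Fin N → ℕ) :
    A ∈ contingency α β ↔ (∀ i, ∑ j, A i j = α i) ∧ ∀ j, ∑ i, A i j = β j := by
  simp [contingency, Finset.mem_piAntidiag]

variable {R : Type*} [CommRing R] {N : ℕ}

/-- Louck's `SU(N)` solid harmonic
`𝒟^p_{αβ}(X) = √(α! β!) ∑_{A ∈ 𝕄_N(α,β)} X^A / A!`, where `α` and `β` are compositions of `p`
into `N` nonnegative parts (so that `p` is determined by `α`). -/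
def solidHarmonic [Algebra ℝ R] (α β : Fin N → ℕ) (X : Matrix (Fin N) (Fin N) R) : R :=
  √(((∏ i, (α i)!) * ∏ i, (β i)! : ℕ) : ℝ) •
    ∑ A ∈ contingency α β, ((∏ i, ∏ j, (A i j)! : ℕ) : ℝ)⁻¹ • ∏ i, ∏ j, X i j ^ A i j

/-- `T_q(X)`: the sum of all principal minors of `X` of order `q`. It is homogeneous of degree `q`
in the entries, `T_0 = 1`, `T_1 = tr`, `T_N = det`. -/
def principalMinorSum (q : ℕ) (X : Matrix (Fin N) (Fin N) R) : R :=
  ∑ s ∈ Finset.powersetCard q (Finset.univ : Finset (Fin N)),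
    (X.submatrix (fun i : s => (i : Fin N)) (fun i : s => (i : Fin N))).det

/-- `T̂_q(X) = (-1)^q (q - 1) T_q(X)`. -/
def That (q : ℕ) (X : Matrix (Fin N) (Fin N) R) : R :=
  (-1) ^ q * ((q : R) - 1) * principalMinorSum q X

/-- Multi-indices `σ = (σ_2, …, σ_N)` of nonnegative integers. -/
abbrev MultiIdx (N : ℕ) : Type := (Finset.Icc 2 N) → ℕ

/-- The weighted degree `∑_{j=2}^N j σ_j`. -/
def weight (σ : MultiIdx N) : ℕ := ∑ j : Finset.Icc 2 N, (j : ℕ) * σ j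

/-- `T̂(X)^σ = T̂_2(X)^{σ_2} ⋯ T̂_N(X)^{σ_N}`. -/
def ThatPow (X : Matrix (Fin N) (Fin N) R) (σ : MultiIdx N) : R :=
  ∏ j : Finset.Icc 2 N, That (j : ℕ) X ^ σ j

/-- The multinomial coefficient `(∑_{j=2}^N γ_j)! / (γ_2! ⋯ γ_N!)`. -/
def multinom (γ : MultiIdx N) : ℕ := Nat.multinomial Finset.univ γ

/-- The range of the nested summation `∑_{γ⁰=0}^{σ} ∑_{γ¹=0}^{σ-γ⁰} ⋯ ∑_{γ^{m-1}=0}^{σ-γ⁰-⋯-γ^{m-2}}`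
over `m` multi-indices: all tuples `(γ⁰, …, γ^{m-1})` with `γ⁰ + ⋯ + γ^{m-1} ≤ σ`
componentwise. -/
def nestedRange (m : ℕ) (σ : MultiIdx N) : Finset (Fin m → MultiIdx N) :=
  {γ ∈ Fintype.piFinset fun _ => Finset.Icc 0 σ | ∀ j, ∑ k, γ k j ≤ σ j}

/-- Sanity check for `nestedRange`: membership is exactly the nested chain of bounds
`γ^k ≤ σ - γ⁰ - ⋯ - γ^{k-1}`. -/
theorem mem_nestedRange (m : ℕ) (σ : MultiIdx N) (γ : Fin m → MultiIdx N) :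
    γ ∈ nestedRange m σ ↔ ∀ k, γ k ≤ σ - ∑ i with i < k, γ i := by
  have key : ∀ k, ∑ i with i ≤ k, γ i = γ k + ∑ i with i < k, γ i := by
    intro k
    rw [show (univ.filter fun i => i ≤ k) = insert k (univ.filter fun i => i < k) by
      ext i; simp [le_iff_eq_or_lt], Finset.sum_insert (by simp)]
  have tot : (∀ j, ∑ k, γ k j ≤ σ j) ↔ ∑ k, γ k ≤ σ := by
    simp [Pi.le_def, Finset.sum_apply]
  simp only [nestedRange, Finset.mem_filter, Fintype.mem_piFinset, Finset.mem_Icc, tot]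
  constructor
  · rintro ⟨-, h⟩ k
    have h2 : ∑ i with i ≤ k, γ i ≤ σ :=
      (Finset.sum_le_sum_of_subset (Finset.filter_subset _ _)).trans h
    exact le_tsub_of_add_le_right (key k ▸ h2)
  · intro h
    refine ⟨fun k => ⟨zero_le, (h k).trans tsub_le_self⟩, ?_⟩
    have part : ∀ n (hn : n < m), ∑ i with i ≤ (⟨n, hn⟩ : Fin m), γ i ≤ σ := by
      intro n
      induction n with
      | zero =>
        intro hn
        rw [key, show (univ.filter fun i => i < (⟨0, hn⟩ : Fin m)) = ∅ by
          ext i; simp [Fin.lt_def]]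
        simpa using (h ⟨0, hn⟩).trans tsub_le_self
      | succ n ih =>
        intro hn
        have hs : (univ.filter fun i => i < (⟨n + 1, hn⟩ : Fin m))
            = univ.filter fun i => i ≤ (⟨n, by omega⟩ : Fin m) := by
          ext i; simp [Fin.lt_def, Fin.le_def]
        have h1 := h ⟨n + 1, hn⟩
        rw [key]
        rw [hs] at h1 ⊢
        exact add_le_of_le_tsub_right_of_le (ih (by omega)) h1
    cases m with
    | zero => simp
    | succ m =>
      have h1 := part m (by omega)
      have hu : (univ.filter fun i => i ≤ (⟨m, by omega⟩ : Fin (m + 1))) = univ := by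
        ext i; simp [Fin.le_def, Nat.lt_succ_iff.mp i.2]
      rwa [hu] at h1

/-- The coefficient `C^λ_{p,σ}`, a sum over the `λ - 2` multi-indices `γ⁰, …, γ^{λ-3}`. For `λ = 2`
there is only the empty tuple, and the coefficient is `multinom σ`. -/
def coeffC (lam p : ℕ) (σ : MultiIdx N) : ℝ :=
  1 / ((lam - 2)! : ℝ) * ∑ γ ∈ nestedRange (lam - 2) σ,
    (multinom (σ - ∑ k, γ k) : ℝ) *
      ∏ k, (multinom (γ k) : ℝ) *
        ((p : ℝ) + ((k : ℕ) : ℝ) + 2 + (weight (∑ i with i ≤ k, γ i) : ℝ))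

end MSMT

end

/-! Let D = det(1 - tX) and let S be the generating function of the traces of the symmetric powers
of X. The diagonal solid harmonics of degree p add up to the p-th such trace
(`sum_solidHarmonic_self`), and MacMahon's theorem gives S = 1/D (`symSeries_mul_charSeries`).

The series `thatSeries`, written Q here, satisfies 1 - Q = D - tD'. Since S' = -D'/D², this yields
S^(m+2) (1 - Q) = S^(m+1) + t (S^(m+1))' / (m+1) (`symSeries_pow_mul_one_sub`). So each further
power of S costs one coefficientwise scaling by (n+m+1)/(m+1) and one factor 1/(1 - Q), a geometric
series in multinomials.

Starting at S, λ - 1 such steps reach S^λ as a sum over p and λ - 1 multi-indices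
(`hasSum_tupleCoeff`). Fixing their total σ determines the last one; the other λ - 2 are the
summation variables of `coeffC`. -/

noncomputable section

namespace MSMT

/-! ### Traces on the graded pieces of the polynomial ring -/

section GradedTrace

open MvPolynomial

variable {R : Type*} [CommRing R] {ι : Type*} [Fintype ι] [DecidableEq ι]

/-- The trace of the degree `p` diagonal block of an endomorphism of the polynomial ring. -/
def gradedTrace (p : ℕ) : Module.End R (MvPolynomial ι R) →ₗ[R] R where
  toFun T := ∑ α ∈ (univ : Finset ι).finsuppAntidiag p, coeff α (T (monomial α 1))
  map_add' S T := by simp [sum_add_distrib]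
  map_smul' c T := by simp [mul_sum]

theorem gradedTrace_apply (p : ℕ) (T : Module.End R (MvPolynomial ι R)) :
    gradedTrace p T = ∑ α ∈ (univ : Finset ι).finsuppAntidiag p, coeff α (T (monomial α 1)) :=
  rfl

/-- Multiplication by the variable `y_j`. -/
def mulVar (j : ι) : Module.End R (MvPolynomial ι R) := LinearMap.mulLeft R (X j)

omit [Fintype ι] [DecidableEq ι] in
theorem mulVar_apply (j : ι) (f : MvPolynomial ι R) : mulVar j f = X j * f := rfl

/-- Partial differentiation `∂/∂y_k`. -/
def diffVar (k : ι) : Module.End R (MvPolynomial ι R) := (pderiv k).toLinearMap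

omit [Fintype ι] [DecidableEq ι] in
theorem diffVar_apply (k : ι) (f : MvPolynomial ι R) : diffVar k f = pderiv k f := rfl

theorem gradedTrace_zero_mulVar (j : ι) (T : Module.End R (MvPolynomial ι R)) :
    gradedTrace 0 (mulVar j * T) = 0 := by
  simp [gradedTrace_apply, mulVar_apply, coeff_X_mul']

/-- Cyclicity of the trace between adjacent degrees: monomials not divisible by y_j contribute
nothing on the left, and the others are y_j times a monomial of degree p. -/
theorem gradedTrace_succ_mulVar (p : ℕ) (j : ι) (T : Module.End R (MvPolynomial ι R)) :
    gradedTrace (p + 1) (mulVar j * T) = gradedTrace p (T * mulVar j) := by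
  symm
  simp only [gradedTrace_apply, Module.End.mul_apply, mulVar_apply]
  refine sum_of_injOn (fun β => β + Finsupp.single j 1) ?_ ?_ ?_ ?_
  · exact fun a _ b _ h => add_right_cancel h
  · intro a ha
    simp only [mem_coe, mem_finsuppAntidiag, Finsupp.coe_add, Pi.add_apply,
      sum_add_distrib] at ha ⊢
    simp [ha.1, Finsupp.single_apply]
  · intro a ha hn
    rw [coeff_X_mul', if_neg]
    intro hj
    refine hn ⟨a - Finsupp.single j 1, ?_, ?_⟩
    · have h1 : a - Finsupp.single j 1 + Finsupp.single j 1 = a :=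
        Finsupp.sub_add_single_one_cancel (Finsupp.mem_support_iff.mp hj)
      have h2 := (mem_finsuppAntidiag.mp ha).1
      rw [← h1] at h2
      simp only [Finsupp.coe_add, Pi.add_apply, sum_add_distrib] at h2
      simp only [Finsupp.single_apply, sum_ite_eq, mem_univ, if_true] at h2
      simpa [mem_finsuppAntidiag] using h2
    · exact Finsupp.sub_add_single_one_cancel (Finsupp.mem_support_iff.mp hj)
  · intro a _
    rw [add_comm a, coeff_X_mul, X, monomial_mul, one_mul]

/-- The substitution `y_i ↦ ∑_j x_ij y_j`. -/
def linSubst (M : Matrix ι ι R) : MvPolynomial ι R →ₐ[R] MvPolynomial ι R :=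
  aeval fun i => ∑ j, C (M i j) * X j

/-- The trace of the `p`-th symmetric power of `M`. -/
def symTrace (M : Matrix ι ι R) (p : ℕ) : R := gradedTrace p (linSubst M).toLinearMap

/-- The traces of `f ↦ (∂_k (y_j f))(M y)`. -/
def shiftTrace (M : Matrix ι ι R) (p : ℕ) : Matrix ι ι R :=
  Matrix.of fun j k => gradedTrace p ((linSubst M).toLinearMap * diffVar k * mulVar j)

/-- Product rule for ∂_k (y_j f), followed by the substitution y_j ↦ ∑ M_jl y_l. In degree p + 1,
cyclicity turns the last sum into M times the previous matrix. -/
theorem shiftTrace_eq (M : Matrix ι ι R) (p : ℕ) (j k : ι) :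
    shiftTrace M p j k = (1 : Matrix ι ι R) j k * symTrace M p +
      ∑ l, M j l * gradedTrace p (mulVar l * ((linSubst M).toLinearMap * diffVar k)) := by
  have : (linSubst M).toLinearMap * diffVar k * mulVar j =
      (1 : Matrix ι ι R) j k • (linSubst M).toLinearMap +
        ∑ l, M j l • (mulVar l * ((linSubst M).toLinearMap * diffVar k)) := by
    ext1 m
    ext1
    simp only [LinearMap.comp_apply, Module.End.mul_apply, mulVar_apply, diffVar_apply,
      AlgHom.toLinearMap_apply, LinearMap.add_apply, LinearMap.smul_apply, LinearMap.sum_apply,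
      pderiv_mul, pderiv_X, map_add, map_mul]
    congr 1
    · by_cases h : j = k
      · subst h; simp
      · simp [h]
    · simp [linSubst, sum_mul, smul_eq_C_mul, mul_assoc]
  simp [shiftTrace, this, symTrace]

theorem shiftTrace_zero (M : Matrix ι ι R) : shiftTrace M 0 = symTrace M 0 • 1 := by
  ext j k
  simp [shiftTrace_eq, gradedTrace_zero_mulVar, mul_comm]

theorem shiftTrace_succ (M : Matrix ι ι R) (p : ℕ) :
    shiftTrace M (p + 1) = symTrace M (p + 1) • 1 + M * shiftTrace M p := by
  ext j k
  rw [shiftTrace_eq]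
  simp [gradedTrace_succ_mulVar, mul_comm, Matrix.mul_apply, shiftTrace]

omit [DecidableEq ι] in
theorem pderiv_linSubst (M : Matrix ι ι R) (i : ι) (f : MvPolynomial ι R) :
    pderiv i (linSubst M f) = ∑ k, C (M k i) * linSubst M (pderiv k f) := by
  classical
  induction f using MvPolynomial.induction_on with
  | C a => simp [linSubst, algebraMap_eq]
  | add f g hf hg => simp [hf, hg, mul_add, sum_add_distrib]
  | mul_X f j hf =>
    have hX : pderiv i (linSubst M (X j)) = C (M j i) := by
      simp [linSubst, pderiv_X, Pi.single_apply]
    rw [map_mul, pderiv_mul, hf, hX]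
    simp only [pderiv_mul, map_add, map_mul, mul_add, sum_add_distrib, pderiv_X, sum_mul]
    congr 1
    · exact sum_congr rfl fun _ _ => by ring
    · rw [sum_eq_single j]
      · simp; ring
      · intro b _ hb
        simp [hb.symm]
      · simp

theorem coeff_sum_X_mul_pderiv (f : MvPolynomial ι R) (α : ι →₀ ℕ) :
    ∑ i, coeff α (X i * pderiv i f) = ((∑ i, α i : ℕ) : R) * coeff α f := by
  push_cast
  rw [sum_mul]
  refine sum_congr rfl fun i _ => ?_
  rw [coeff_X_mul']
  split_ifs with h
  · have h0 := Finsupp.mem_support_iff.mp h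
    rw [coeff_pderiv, Finsupp.sub_add_single_one_cancel h0]
    have : 1 ≤ α i := Nat.one_le_iff_ne_zero.mpr h0
    simp [this, mul_comm]
  · simp [Finsupp.notMem_support_iff.mp h]

/-- Euler's identity: ∑ y_i ∂_i acts as p in degree p. The chain rule then moves ∂_i past the
substitution. -/
theorem mul_symTrace (M : Matrix ι ι R) (p : ℕ) :
    (p : R) * symTrace M p =
      ∑ i, ∑ k, M k i * gradedTrace p (mulVar i * ((linSubst M).toLinearMap * diffVar k)) := by
  have : ∀ i, ∑ k, M k i • (mulVar i * ((linSubst M).toLinearMap * diffVar k)) =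
      mulVar i * (diffVar i * (linSubst M).toLinearMap) := by
    intro i
    ext1 m
    ext1
    simp [mulVar_apply, diffVar_apply, pderiv_linSubst, smul_eq_C_mul]
    exact sum_congr rfl fun _ _ => by ring
  have h2 : ∀ i, ∑ k, M k i * gradedTrace p (mulVar i * ((linSubst M).toLinearMap * diffVar k)) =
      gradedTrace p (mulVar i * (diffVar i * (linSubst M).toLinearMap)) := by
    intro i; rw [← this]; simp
  simp only [h2]
  simp only [gradedTrace_apply, symTrace, Module.End.mul_apply, mulVar_apply, diffVar_apply]
  rw [sum_comm, mul_sum]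
  refine sum_congr rfl fun α hα => ?_
  rw [coeff_sum_X_mul_pderiv, (mem_finsuppAntidiag.mp hα).1]

theorem succ_mul_symTrace (M : Matrix ι ι R) (p : ℕ) :
    ((p : R) + 1) * symTrace M (p + 1) = (M * shiftTrace M p).trace := by
  have := mul_symTrace M (p + 1)
  push_cast at this
  rw [this, sum_comm]
  simp [Matrix.trace, Matrix.mul_apply, shiftTrace, gradedTrace_succ_mulVar, mul_assoc]

theorem symTrace_zero (M : Matrix ι ι R) : symTrace M 0 = 1 := by
  simp [symTrace, gradedTrace_apply]

end GradedTrace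

/-! ### Derivative of a determinant -/

section Jacobi

theorem derivation_prod {A B : Type*} [CommRing A] [CommRing B] [Algebra A B]
    {ι : Type*} [DecidableEq ι] (D : Derivation A B B) (s : Finset ι) (f : ι → B) :
    D (∏ i ∈ s, f i) = ∑ i ∈ s, D (f i) * ∏ j ∈ s.erase i, f j := by
  induction s using Finset.induction_on with
  | empty => simp
  | insert a s ha ih =>
    rw [prod_insert ha, Derivation.leibniz, ih, sum_insert ha, erase_insert ha, smul_eq_mul,
      smul_eq_mul, add_comm, mul_comm, mul_sum]
    congr 1
    refine sum_congr rfl fun i hi => ?_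
    have hia : a ≠ i := fun h => ha (h ▸ hi)
    rw [erase_insert_of_ne hia, prod_insert (fun h => ha (mem_of_mem_erase h))]
    ring

/-- Jacobi's formula. -/
theorem derivation_det {A B : Type*} [CommRing A] [CommRing B] [Algebra A B]
    {ι : Type*} [Fintype ι] [DecidableEq ι] (D : Derivation A B B) (M : Matrix ι ι B) :
    D M.det = (M.adjugate * M.map D).trace := by
  -- Leibniz on each permutation product, regrouped by the column being differentiated; each summand
  -- is then a Cramer determinant.
  have h1 : D M.det = ∑ j, (M.updateCol j fun i => D (M i j)).det := by
    simp only [Matrix.det_apply, map_sum]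
    rw [sum_comm]
    refine sum_congr rfl fun σ _ => ?_
    rw [← smul_sum, Units.smul_def, Units.smul_def, map_zsmul, derivation_prod]
    congr 1
    refine sum_congr rfl fun j _ => ?_
    rw [← mul_prod_erase univ _ (mem_univ j)]
    congr 1
    · simp
    · refine prod_congr rfl fun i hi => ?_
      rw [Matrix.updateCol_ne (ne_of_mem_erase hi)]
  rw [h1, Matrix.trace]
  refine sum_congr rfl fun j _ => ?_
  rw [← Matrix.cramer_apply, Matrix.cramer_eq_adjugate_mulVec]
  simp [Matrix.mul_apply, Matrix.mulVec, dotProduct]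

end Jacobi

/-! ### MacMahon's master theorem -/

section MacMahon

open PowerSeries

variable {R : Type*} [CommRing R] {ι : Type*} [Fintype ι] [DecidableEq ι]

/-- `det (1 - t M)` as a power series in `t`. -/
def charSeries (M : Matrix ι ι R) : R⟦X⟧ := (1 - (X : R⟦X⟧) • M.map (C : R →+* R⟦X⟧)).det

/-- The generating function of the traces of the symmetric powers of `M`. -/
def symSeries (M : Matrix ι ι R) : R⟦X⟧ := PowerSeries.mk (symTrace M)

theorem charSeries_eq_coe (M : Matrix ι ι R) :
    charSeries M =
      ((1 + (Polynomial.X : Polynomial R) • (-M).map Polynomial.C).det : Polynomial R) := by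
  rw [charSeries, ← Polynomial.coeToPowerSeries.ringHom_apply, RingHom.map_det]
  congr 1
  ext i j : 1
  by_cases h : i = j <;>
    simp [h, RingHom.mapMatrix_apply, sub_eq_add_neg, commute_X _ |>.eq]

theorem constantCoeff_charSeries (M : Matrix ι ι R) : constantCoeff (charSeries M) = 1 := by
  rw [charSeries, RingHom.map_det]
  have : constantCoeff.mapMatrix (1 - (X : R⟦X⟧) • M.map (C : R →+* R⟦X⟧)) = 1 := by
    ext i j : 1
    rcases eq_or_ne i j with rfl | h <;> simp [*]
  rw [this, Matrix.det_one]

theorem isUnit_charSeries (M : Matrix ι ι R) : IsUnit (charSeries M) := by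
  rw [PowerSeries.isUnit_iff_constantCoeff, constantCoeff_charSeries]
  exact isUnit_one

/-- The generating function of the matrices `shiftTrace M p`. -/
def shiftSeries (M : Matrix ι ι R) : Matrix ι ι R⟦X⟧ :=
  Matrix.of fun j k => PowerSeries.mk fun p => shiftTrace M p j k

theorem one_sub_mul_shiftSeries (M : Matrix ι ι R) :
    (1 - (X : R⟦X⟧) • M.map (C : R →+* R⟦X⟧)) * shiftSeries M = symSeries M • 1 := by
  rw [sub_mul, one_mul, sub_eq_iff_eq_add]
  ext j k p
  have hX : ∀ p, coeff p (((X : R⟦X⟧) • M.map (C : R →+* R⟦X⟧) * shiftSeries M) j k) =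
      coeff p (X * ∑ l, C (M j l) * shiftSeries M l k) := by
    intro p
    simp [Matrix.mul_apply, mul_sum, mul_assoc]
  have h1 : ∀ p, coeff p ((symSeries M • (1 : Matrix ι ι R⟦X⟧)) j k) =
      (symTrace M p • (1 : Matrix ι ι R)) j k := by
    intro p
    by_cases h : j = k <;> simp [h, symSeries]
  rw [Matrix.add_apply, map_add, hX, h1]
  cases p with
  | zero => simp [shiftSeries, shiftTrace_zero]
  | succ p =>
    rw [coeff_succ_X_mul]
    simp [shiftSeries, shiftTrace_succ, Matrix.mul_apply]

theorem derivative_symSeries (M : Matrix ι ι R) :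
    d⁄dX R (symSeries M) = (M.map (C : R →+* R⟦X⟧) * shiftSeries M).trace := by
  ext p
  rw [coeff_derivative, symSeries, coeff_mk, mul_comm, succ_mul_symTrace]
  simp [Matrix.trace, Matrix.mul_apply, shiftSeries]

theorem derivative_charSeries (M : Matrix ι ι R) :
    d⁄dX R (charSeries M) =
      -((1 - (X : R⟦X⟧) • M.map (C : R →+* R⟦X⟧)).adjugate * M.map (C : R →+* R⟦X⟧)).trace := by
  rw [charSeries, derivation_det, ← Matrix.trace_neg, ← Matrix.mul_neg]
  congr 2
  ext i j : 1
  have h1 : d⁄dX R ((1 : Matrix ι ι R⟦X⟧) i j) = 0 := by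
    rcases eq_or_ne i j with rfl | h
    · simp
    · rw [Matrix.one_apply_ne h, map_zero]
  simp only [Matrix.map_apply, Matrix.sub_apply, map_sub, h1, Matrix.smul_apply, smul_eq_mul,
    Derivation.leibniz, derivative_C, derivative_X, Matrix.neg_apply]
  simp

/-- **MacMahon's master theorem**, in the form of the generating function of the traces of the
symmetric powers. -/
theorem symSeries_mul_charSeries [IsAddTorsionFree R] (M : Matrix ι ι R) :
    symSeries M * charSeries M = 1 := by
  refine derivative.ext ?_ ?_
  · have h : charSeries M • shiftSeries M =
        symSeries M • (1 - (X : R⟦X⟧) • M.map (C : R →+* R⟦X⟧)).adjugate := by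
      have := congrArg ((1 - (X : R⟦X⟧) • M.map (C : R →+* R⟦X⟧)).adjugate * ·)
        (one_sub_mul_shiftSeries M)
      simpa [← Matrix.mul_assoc, Matrix.adjugate_mul, charSeries] using this
    rw [Derivation.leibniz, derivative_charSeries, derivative_symSeries, smul_neg,
      Derivation.map_one_eq_zero, ← Matrix.trace_smul (charSeries M), ← Matrix.mul_smul, h,
      Matrix.mul_smul, Matrix.trace_smul, Matrix.trace_mul_comm,
      neg_add_cancel]
  · simp [constantCoeff_charSeries, symSeries, symTrace_zero]

end MacMahon
-- Solid harmonics as matrix entries of symmetric powers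
section SolidHarmonic

open MvPolynomial

variable {R : Type*} [CommRing R] {N : ℕ}

/-- The multinomial theorem expands the power of each row form; extracting y^α imposes the column
sums. -/
theorem coeff_linSubst_monomial (M : Matrix (Fin N) (Fin N) R) (α : Fin N →₀ ℕ) :
    coeff α (linSubst M (monomial α 1)) =
      ∑ A ∈ contingency α α,
        (∏ i, (Nat.multinomial univ (A i) : R)) * ∏ i, ∏ j, M i j ^ A i j := by
  have hterm : ∀ A : Fin N → Fin N → ℕ,
      (∏ i, ((Nat.multinomial univ (A i) : ℕ) : MvPolynomial (Fin N) R) *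
          ∏ j, (C (M i j) * X j) ^ A i j) =
        monomial (Finsupp.equivFunOnFinite.symm fun j => ∑ i, A i j)
          ((∏ i, (Nat.multinomial univ (A i) : R)) * ∏ i, ∏ j, M i j ^ A i j) := by
    intro A
    rw [monomial_eq, Finsupp.prod_fintype _ _ (by simp)]
    simp only [mul_pow, prod_mul_distrib, map_mul, map_prod, map_pow, map_natCast,
      Finsupp.equivFunOnFinite_symm_apply_apply]
    rw [mul_assoc]
    congr 2
    rw [prod_comm]
    simp [prod_pow_eq_pow_sum]
  rw [linSubst, aeval_monomial, Finsupp.prod_fintype _ _ (by simp), map_one, one_mul]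
  simp only [sum_pow_eq_sum_piAntidiag, prod_univ_sum, hterm, coeff_sum, coeff_monomial]
  rw [contingency, sum_filter]
  refine sum_congr rfl fun A _ => ?_
  congr 1
  simp [Finsupp.ext_iff]

/-- On the diagonal the square root is α!, and α!/A! is the product of the row multinomials. -/
theorem solidHarmonic_self [Algebra ℝ R] (M : Matrix (Fin N) (Fin N) R) (α : Fin N → ℕ) :
    solidHarmonic α α M =
      ∑ A ∈ contingency α α,
        (∏ i, (Nat.multinomial univ (A i) : R)) * ∏ i, ∏ j, M i j ^ A i j := by
  have hs : √(((∏ i, (α i)!) * ∏ i, (α i)! : ℕ) : ℝ) = ((∏ i, (α i)! : ℕ) : ℝ) := by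
    rw [Nat.cast_mul, Real.sqrt_mul_self (Nat.cast_nonneg _)]
  rw [solidHarmonic, hs, smul_sum]
  refine sum_congr rfl fun A hA => ?_
  have hrow := ((mem_contingency α α A).mp hA).1
  have h1 : (∏ i, ∏ j, (A i j)!) * ∏ i, Nat.multinomial univ (A i) = ∏ i, (α i)! := by
    rw [← prod_mul_distrib]
    exact prod_congr rfl fun i _ => by rw [Nat.multinomial_spec, hrow]
  have h0 : ((∏ i, ∏ j, (A i j)! : ℕ) : ℝ) ≠ 0 :=
    Nat.cast_ne_zero.mpr (prod_ne_zero_iff.mpr fun i _ =>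
      prod_ne_zero_iff.mpr fun j _ => Nat.factorial_ne_zero _)
  rw [smul_smul, ← h1, Nat.cast_mul, mul_comm, inv_mul_cancel_left₀ h0, Algebra.smul_def,
    map_natCast, Nat.cast_prod]

theorem sum_solidHarmonic_self [Algebra ℝ R] (M : Matrix (Fin N) (Fin N) R) (p : ℕ) :
    ∑ α ∈ piAntidiag univ p, solidHarmonic α α M = symTrace M p := by
  rw [symTrace, gradedTrace_apply]
  refine sum_nbij' (fun α => Finsupp.equivFunOnFinite.symm α) (fun α => α) ?_ ?_ ?_ ?_ ?_
  · intro α hα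
    simpa [mem_finsuppAntidiag, mem_piAntidiag] using hα
  · intro α hα
    simpa [mem_finsuppAntidiag, mem_piAntidiag] using hα
  · intro α _
    simp
  · intro α _
    ext; simp
  · intro α _
    rw [AlgHom.toLinearMap_apply, coeff_linSubst_monomial, solidHarmonic_self]
    simp

end SolidHarmonic

/-! ### The series of the T̂_j -/

section ThatSeries

open PowerSeries

variable {R : Type*} [CommRing R] {N : ℕ}

theorem coeff_charSeries (M : Matrix (Fin N) (Fin N) R) (q : ℕ) :
    coeff q (charSeries M) = (-1) ^ q * principalMinorSum q M := by
  rw [charSeries_eq_coe, Polynomial.coeff_coe, Matrix.coeff_det_one_add_X_smul_eq_sum_minors,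
    principalMinorSum, mul_sum]
  refine sum_congr rfl fun s hs => ?_
  rw [Matrix.submatrix_neg, Pi.neg_apply, Pi.neg_apply, Matrix.det_neg, Fintype.card_coe,
    (mem_powersetCard.mp hs).2]

/-- `∑_{j=2}^N T̂_j(M) t^j`. -/
def thatSeries (M : Matrix (Fin N) (Fin N) R) : R⟦X⟧ :=
  ∑ j : Finset.Icc 2 N, C (That (j : ℕ) M) * X ^ (j : ℕ)

theorem constantCoeff_thatSeries (M : Matrix (Fin N) (Fin N) R) :
    constantCoeff (thatSeries M) = 0 := by
  rw [thatSeries, map_sum]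
  refine sum_eq_zero fun j _ => ?_
  have := (mem_Icc.mp j.2).1
  simp [show (j : ℕ) ≠ 0 by omega]

/-- The operator f ↦ f - t f' scales the n-th coefficient by 1 - n. The result is 1 at n = 0, and 0
at n = 1 and for n > N, which leaves the range 2, …, N. -/
theorem one_sub_thatSeries (M : Matrix (Fin N) (Fin N) R) :
    1 - thatSeries M = charSeries M - X * d⁄dX R (charSeries M) := by
  have hR : ∀ n, coeff n (charSeries M - X * d⁄dX R (charSeries M)) = -That n M := by
    intro n
    cases n with
    | zero =>
      rw [map_sub, coeff_zero_X_mul, coeff_charSeries, That]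
      simp
    | succ n =>
      rw [map_sub, coeff_succ_X_mul, coeff_derivative, coeff_charSeries, That]
      push_cast
      ring
  have hS : ∀ n, coeff n (thatSeries M) = if n ∈ Icc 2 N then That n M else 0 := by
    intro n
    rw [thatSeries, map_sum, univ_eq_attach,
      sum_attach (Icc 2 N) fun j => coeff n (C (That j M) * X ^ j)]
    simp [coeff_X_pow]
  ext n
  rw [hR, map_sub, hS]
  split_ifs with h
  · have : n ≠ 0 := by have := mem_Icc.mp h; omega
    simp [coeff_one, this]
  · obtain rfl | rfl | hn : n = 0 ∨ n = 1 ∨ N < n := by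
      rw [mem_Icc] at h; omega
    · simp [That, principalMinorSum]
    · simp [That, coeff_one]
    · rw [That, principalMinorSum, powersetCard_eq_empty.mpr (by simpa using hn)]
      simp [coeff_one, show n ≠ 0 by omega]

end ThatSeries

theorem hasSum_finset_fiberwise {α β γ : Type*} [AddCommMonoid α] [TopologicalSpace α]
    [ContinuousAdd α] [RegularSpace α] {f : β → α} {a : α} (hf : HasSum f a) (g : β → γ)
    (F : γ → Finset β) (hF : ∀ c b, b ∈ F c ↔ g b = c) :
    HasSum (fun c => ∑ b ∈ F c, f b) a := by
  have h1 : HasSum (fun x : Σ c, {b // g b = c} => f x.2) a :=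
    (Equiv.sigmaFiberEquiv g).hasSum_iff.mpr hf
  refine h1.sigma fun c => ?_
  have h2 : HasSum (fun b : {b // b ∈ F c} => f b) (∑ b ∈ F c, f b) := (F c).hasSum f
  exact (Equiv.hasSum_iff (Equiv.subtypeEquivRight fun b => hF c b)
    (f := fun b : {b // g b = c} => f b)).mp h2

/-! ### Recursion between powers of 1/det(1 - tX) -/

section Recursion

open PowerSeries

variable {R : Type*} [CommRing R] [Algebra ℝ R] {N : ℕ}

/-- The operator `f ↦ f + t f' / (m + 1)`, which multiplies the `n`-th coefficient
by `(n + m + 1) / (m + 1)`. -/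
def eulerOp (m : ℕ) (f : R⟦X⟧) : R⟦X⟧ := f + (1 / ((m : ℝ) + 1)) • (X * d⁄dX R f)

theorem coeff_eulerOp (m n : ℕ) (f : R⟦X⟧) :
    coeff n (eulerOp m f) = (((n : ℝ) + m + 1) / (m + 1)) • coeff n f := by
  have hm : (m : ℝ) + 1 ≠ 0 := by positivity
  have h : coeff n (X * d⁄dX R f) = (n : ℝ) • coeff n f := by
    cases n with
    | zero => simp
    | succ n =>
      rw [coeff_succ_X_mul, coeff_derivative, Algebra.smul_def, mul_comm]
      simp
  rw [eulerOp, map_add, PowerSeries.coeff_smul, h, smul_smul]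
  nth_rw 1 [← one_smul ℝ (coeff n f)]
  rw [← add_smul]
  congr 1
  field_simp
  ring

theorem eulerOp_smul_X_pow_mul_C (m n : ℕ) (c : ℝ) (a : R) :
    eulerOp m (c • ((X : R⟦X⟧) ^ n * C a)) =
      (c * (((n : ℝ) + m + 1) / (m + 1))) • ((X : R⟦X⟧) ^ n * C a) := by
  ext k
  rw [coeff_eulerOp, PowerSeries.coeff_smul, PowerSeries.coeff_smul, smul_smul]
  by_cases h : k = n
  · rw [h, mul_comm]
  · simp [coeff_X_pow, h]

theorem symSeries_pow_mul_one_sub (M : Matrix (Fin N) (Fin N) R) (m : ℕ) :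
    symSeries M ^ (m + 2) * (1 - thatSeries M) = eulerOp m (symSeries M ^ (m + 1)) := by
  have : IsAddTorsionFree R := .of_isTorsionFree ℝ R
  have h := symSeries_mul_charSeries M
  have h' := congrArg (d⁄dX R) h
  rw [Derivation.leibniz, Derivation.map_one_eq_zero, smul_eq_mul, smul_eq_mul] at h'
  have h2 : d⁄dX R (symSeries M ^ (m + 1)) =
      ((m : ℝ) + 1) • (symSeries M ^ m * d⁄dX R (symSeries M)) := by
    rw [derivative_pow, Algebra.smul_def]
    simp [mul_assoc]
  have hm : (m : ℝ) + 1 ≠ 0 := by positivity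
  rw [eulerOp, h2, one_sub_thatSeries, mul_smul_comm, smul_smul, one_div_mul_cancel hm, one_smul]
  -- Here `h` is S D = 1 and `h'` its derivative S D' + D S' = 0.
  linear_combination (symSeries M ^ (m + 1) + X * symSeries M ^ m * d⁄dX R (symSeries M)) * h -
    X * symSeries M ^ (m + 1) * h'

end Recursion

/-! ### Weights of multi-indices and finiteness -/

section MultiIdx

variable {N : ℕ}

theorem weight_add (σ τ : MultiIdx N) : weight (σ + τ) = weight σ + weight τ := by
  simp [weight, mul_add, sum_add_distrib]

theorem weight_zero : weight (0 : MultiIdx N) = 0 := by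
  simp [weight]

theorem le_weight (σ : MultiIdx N) (j : Finset.Icc 2 N) : σ j ≤ weight σ := by
  refine le_trans ?_ (single_le_sum (f := fun j : Finset.Icc 2 N => (j : ℕ) * σ j)
    (fun _ _ => Nat.zero_le _) (mem_univ j))
  exact Nat.le_mul_of_pos_left _ (by have := (mem_Icc.mp j.2).1; omega)

theorem ThatPow_add {R : Type*} [CommRing R] (M : Matrix (Fin N) (Fin N) R) (σ τ : MultiIdx N) :
    ThatPow M (σ + τ) = ThatPow M σ * ThatPow M τ := by
  simp [ThatPow, pow_add, prod_mul_distrib]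

theorem finite_setOf_weight_eq (n : ℕ) : {σ : MultiIdx N | weight σ = n}.Finite :=
  (Set.finite_Icc (0 : MultiIdx N) fun _ => n).subset fun σ hσ =>
    ⟨fun _ => Nat.zero_le _, fun j => (le_weight σ j).trans hσ.le⟩

theorem finite_setOf_add_weight_sum_eq (m n : ℕ) :
    {x : ℕ × (Fin m → MultiIdx N) | x.1 + weight (∑ k, x.2 k) = n}.Finite := by
  refine ((Set.finite_Iic n).prod
    (Set.Finite.pi' fun _ : Fin m => Set.finite_Icc (0 : MultiIdx N) fun _ => n)).subset ?_
  rintro ⟨p, g⟩ (h : p + weight (∑ k, g k) = n)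
  refine ⟨(Nat.le_add_right _ _).trans h.le, fun k => ⟨fun _ => Nat.zero_le _, fun j => ?_⟩⟩
  have h1 : g k j ≤ (∑ k, g k) j := by
    rw [Finset.sum_apply]
    exact single_le_sum (f := fun k => g k j) (fun _ _ => Nat.zero_le _) (mem_univ k)
  have h2 := le_weight (∑ k, g k) j
  change g k j ≤ n
  omega

end MultiIdx

/-! ### Iterating the recursion and collecting coefficients -/

section Sums

open PowerSeries

variable {R : Type*} [CommRing R] [Algebra ℝ R] [TopologicalSpace R] [DiscreteTopology R] {N : ℕ}

omit [DiscreteTopology R] in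
theorem summable_smul_X_pow_mul_C {ι : Type*} (d : ι → ℕ) (hd : ∀ n, {i | d i = n}.Finite)
    (c : ι → ℝ) (a : ι → R) :
    Summable fun i => c i • ((X : R⟦X⟧) ^ d i * C (a i)) := by
  rw [WithPiTopology.summable_iff_summable_coeff]
  intro n
  refine summable_of_hasFiniteSupport ((hd n).subset fun i hi => ?_)
  by_contra h
  exact hi (by simp [coeff_X_pow, show n ≠ d i from fun h' => h h'.symm])

theorem hasSum_eulerOp {ι : Type*} (m : ℕ) {f : ι → R⟦X⟧} {a : R⟦X⟧} (hf : HasSum f a) :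
    HasSum (fun i => eulerOp m (f i)) (eulerOp m a) := by
  rw [WithPiTopology.hasSum_iff_hasSum_coeff] at hf ⊢
  intro n
  simp only [coeff_eulerOp]
  exact (hf n).map (DistribSMul.toAddMonoidHom R (((n : ℝ) + m + 1) / (m + 1)))
    continuous_of_discreteTopology

/-- Grouping by |γ| = n gives the n-th power of `thatSeries M`, by the multinomial theorem, so the
total is a geometric series. -/
theorem exists_hasSum_multinom (M : Matrix (Fin N) (Fin N) R) :
    ∃ G : R⟦X⟧, (1 - thatSeries M) * G = 1 ∧
      HasSum (fun γ : MultiIdx N =>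
        (multinom γ : ℝ) • ((X : R⟦X⟧) ^ weight γ * C (ThatPow M γ))) G := by
  obtain ⟨G, hG⟩ := summable_smul_X_pow_mul_C weight (finite_setOf_weight_eq (N := N))
    (fun γ => (multinom γ : ℝ)) (ThatPow M)
  refine ⟨G, ?_, hG⟩
  have h := hasSum_finset_fiberwise hG (fun γ => ∑ j, γ j) (fun n => piAntidiag univ n)
    (by simp [mem_piAntidiag])
  have hpow : ∀ n, ∑ γ ∈ piAntidiag univ n,
      (multinom γ : ℝ) • ((X : R⟦X⟧) ^ weight γ * C (ThatPow M γ)) = thatSeries M ^ n := by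
    intro n
    rw [thatSeries, sum_pow_eq_sum_piAntidiag]
    refine sum_congr rfl fun γ _ => ?_
    rw [Algebra.smul_def, map_natCast, multinom, ThatPow, weight, mul_comm (X ^ _)]
    simp [mul_pow, prod_mul_distrib, ← pow_mul, prod_pow_eq_pow_sum]
  simp only [hpow] at h
  rw [← h.tsum_eq]
  exact WithPiTopology.one_sub_mul_tsum_pow_of_constantCoeff_eq_zero (constantCoeff_thatSeries M)

/-- The coefficients obtained by iterating the recursion of `symSeries_pow_mul_one_sub`. -/
def tupleCoeff (m p : ℕ) (g : Fin m → MultiIdx N) : ℝ :=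
  (∏ k, (multinom (g k) : ℝ)) *
    ∏ k : Fin m, ((p : ℝ) + weight (∑ i with i < k, g i) + (k : ℕ) + 1) / ((k : ℕ) + 1)

theorem tupleCoeff_snoc (m p : ℕ) (g : Fin m → MultiIdx N) (γ : MultiIdx N) :
    tupleCoeff (m + 1) p (Fin.snoc (α := fun _ => MultiIdx N) g γ) =
      tupleCoeff m p g * (((p + weight (∑ k, g k) : ℕ) + (m : ℝ) + 1) / (m + 1)) *
        multinom γ := by
  simp only [tupleCoeff, Fin.prod_univ_castSucc, sum_filter, Fin.sum_univ_castSucc,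
    Fin.snoc_castSucc, Fin.snoc_last, Fin.castSucc_lt_castSucc_iff, Fin.castSucc_lt_last,
    Fin.val_castSucc, Fin.val_last]
  simp [not_lt.mpr (Fin.le_last _)]
  ring

theorem hasSum_tupleCoeff (M : Matrix (Fin N) (Fin N) R) (m : ℕ) :
    HasSum (fun x : ℕ × (Fin m → MultiIdx N) =>
      tupleCoeff m x.1 x.2 • ((X : R⟦X⟧) ^ (x.1 + weight (∑ k, x.2 k)) *
        C (ThatPow M (∑ k, x.2 k) * symTrace M x.1))) (symSeries M ^ (m + 1)) := by
  induction m with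
  | zero =>
    rw [← (Equiv.prodUnique ℕ (Fin 0 → MultiIdx N)).symm.hasSum_iff]
    have h : ∀ p, (X : R⟦X⟧) ^ p * C (symTrace M p) = monomial p (coeff p (symSeries M)) := by
      intro p
      rw [symSeries, coeff_mk, monomial_eq_C_mul_X_pow, mul_comm]
    simpa [Function.comp_def, tupleCoeff, weight_zero, ThatPow, h] using
      PowerSeries.hasSum_of_monomials_self (symSeries M)
  | succ m ih =>
    obtain ⟨G, hG1, hG⟩ := exists_hasSum_multinom M
    have hprod : symSeries M ^ (m + 1 + 1) = eulerOp m (symSeries M ^ (m + 1)) * G := by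
      rw [← symSeries_pow_mul_one_sub, mul_assoc, hG1, mul_one]
    -- The new geometric factor contributes the last entry of the tuple.
    let e : (ℕ × (Fin m → MultiIdx N)) × MultiIdx N ≃ ℕ × (Fin (m + 1) → MultiIdx N) :=
      { toFun := fun x => (x.1.1, Fin.snoc (α := fun _ => MultiIdx N) x.1.2 x.2)
        invFun := fun y => ((y.1, Fin.init y.2), y.2 (Fin.last m))
        left_inv := fun x => by simp
        right_inv := fun y => by simp }
    have hterm : ∀ x : (ℕ × (Fin m → MultiIdx N)) × MultiIdx N,
        eulerOp m (tupleCoeff m x.1.1 x.1.2 • ((X : R⟦X⟧) ^ (x.1.1 + weight (∑ k, x.1.2 k)) *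
          C (ThatPow M (∑ k, x.1.2 k) * symTrace M x.1.1))) *
          ((multinom x.2 : ℝ) • ((X : R⟦X⟧) ^ weight x.2 * C (ThatPow M x.2))) =
        tupleCoeff (m + 1) (e x).1 (e x).2 •
          ((X : R⟦X⟧) ^ ((e x).1 + weight (∑ k, (e x).2 k)) *
            C (ThatPow M (∑ k, (e x).2 k) * symTrace M (e x).1)) := by
      rintro ⟨⟨p, g⟩, γ⟩
      simp only [e, Equiv.coe_fn_mk]
      rw [eulerOp_smul_X_pow_mul_C, tupleCoeff_snoc, smul_mul_smul_comm, Fin.sum_univ_castSucc]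
      simp only [Fin.snoc_castSucc, Fin.snoc_last, weight_add, ThatPow_add, map_mul]
      congr 1
      ring
    have hsum := summable_smul_X_pow_mul_C _ (finite_setOf_add_weight_sum_eq (N := N) (m + 1))
      (fun x => tupleCoeff (m + 1) x.1 x.2) (fun x => ThatPow M (∑ k, x.2 k) * symTrace M x.1)
    rw [hprod, ← e.hasSum_iff]
    have hmul := (hasSum_eulerOp m ih).mul hG
    simp only [hterm] at hmul
    exact hmul ((e.summable_iff).mpr hsum)

theorem mem_nestedRange_iff_sum_le (m : ℕ) (σ : MultiIdx N) (γ : Fin m → MultiIdx N) :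
    γ ∈ nestedRange m σ ↔ ∑ k, γ k ≤ σ := by
  simp only [nestedRange, mem_filter, Fintype.mem_piFinset, mem_Icc, Pi.le_def, Finset.sum_apply,
    and_iff_right_iff_imp]
  intro h k
  exact ⟨fun _ => Nat.zero_le _, fun j => (single_le_sum (f := fun k => γ k j)
    (fun _ _ => Nat.zero_le _) (mem_univ k)).trans (h j)⟩

/-- The k = 0 factor has an empty partial sum and gives p + 1. Shifting k by one in the others turns
i < k + 1 into i ≤ k, and the denominators multiply to (m + 1)!. -/
theorem tupleCoeff_snoc_sub (m p : ℕ) (γ : Fin m → MultiIdx N) (τ : MultiIdx N) :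
    tupleCoeff (m + 1) p (Fin.snoc (α := fun _ => MultiIdx N) γ τ) =
      ((p : ℝ) + 1) / (m + 1)! * (multinom τ *
      ∏ k, (multinom (γ k) : ℝ) *
        ((p : ℝ) + ((k : ℕ) : ℝ) + 2 + (weight (∑ i with i ≤ k, γ i) : ℝ))) := by
  have hfac : ∀ m : ℕ, ∏ k : Fin m, (((k : ℕ) : ℝ) + 1 + 1) = (m + 1)! := by
    intro m
    induction m with
    | zero => simp
    | succ m ih =>
      rw [Fin.prod_univ_castSucc, Nat.factorial_succ (m + 1)]
      simp [ih]
      ring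
  rw [tupleCoeff, Fin.prod_univ_castSucc, Fin.prod_univ_succ]
  simp only [sum_filter, Fin.sum_univ_castSucc, Fin.snoc_castSucc, Fin.snoc_last,
    Fin.castSucc_lt_succ_iff, not_lt.mpr (Fin.le_last _), if_false, add_zero, Fin.not_lt_zero,
    sum_const_zero, weight_zero, Fin.val_succ, Fin.val_zero]
  push_cast
  rw [prod_div_distrib, hfac, prod_mul_distrib]
  have : ∀ k : Fin m, (p : ℝ) + (weight (∑ i, if i ≤ k then γ i else 0) : ℝ) + ((k : ℕ) + 1) + 1 =
    p + (k : ℕ) + 2 + (weight (∑ i, if i ≤ k then γ i else 0) : ℝ) := fun k => by ring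
  simp only [this]
  ring

theorem sum_tupleCoeff (m p : ℕ) (σ : MultiIdx N) :
    ∑ γ ∈ nestedRange m σ,
        tupleCoeff (m + 1) p (Fin.snoc (α := fun _ => MultiIdx N) γ (σ - ∑ k, γ k)) =
      ((p : ℝ) + 1) / (((m + 2 : ℕ) : ℝ) - 1) * coeffC (m + 2) p σ := by
  simp only [tupleCoeff_snoc_sub, ← mul_sum]
  rw [coeffC, ← mul_assoc, Nat.factorial_succ]
  congr 1
  push_cast
  field_simp
  rw [eq_div_iff (by linarith [(Nat.cast_nonneg m : (0 : ℝ) ≤ m)])]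
  ring

end Sums

end MSMT

end

theorem theorem6 {R : Type*} [CommRing R] [Algebra ℝ R]
    [TopologicalSpace R] [DiscreteTopology R]
    (lam : ℕ) (hlam : 2 ≤ lam) (N : ℕ) (X : Matrix (Fin N) (Fin N) R) :
    IsUnit (1 - (PowerSeries.X : R⟦X⟧) • X.map (PowerSeries.C : R →+* R⟦X⟧)).det ∧
    HasSum
      (fun pσ : ℕ × MSMT.MultiIdx N =>
        (((pσ.1 : ℝ) + 1) / ((lam : ℝ) - 1)) •
          ((PowerSeries.X : R⟦X⟧) ^ (pσ.1 + MSMT.weight pσ.2) *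
            PowerSeries.C (MSMT.coeffC lam pσ.1 pσ.2 •
              (MSMT.ThatPow X pσ.2 *
                ∑ α ∈ Finset.piAntidiag Finset.univ pσ.1, MSMT.solidHarmonic α α X))))
      (Ring.inverse (1 - (PowerSeries.X : R⟦X⟧) •
        X.map (PowerSeries.C : R →+* R⟦X⟧)).det ^ lam) := by
  refine ⟨MSMT.isUnit_charSeries X, ?_⟩
  have : IsAddTorsionFree R := .of_isTorsionFree ℝ R
  obtain ⟨m, rfl⟩ : ∃ m, lam = m + 2 := ⟨lam - 2, by omega⟩
  have hinv : Ring.inverse (MSMT.charSeries X) = MSMT.symSeries X :=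
    ((Ring.eq_mul_inverse_iff_mul_eq _ 1 _ (MSMT.isUnit_charSeries X)).mpr
      (MSMT.symSeries_mul_charSeries X)).trans (one_mul _) |>.symm
  change HasSum _ (Ring.inverse (MSMT.charSeries X) ^ (m + 2))
  rw [hinv]
  -- Tuples of m + 1 multi-indices with total σ correspond to m-tuples with sum at most σ, completed
  -- by the remainder.
  have hinj : ∀ pσ : ℕ × MSMT.MultiIdx N, Function.Injective fun γ : Fin m → MSMT.MultiIdx N =>
      ((pσ.1, Fin.snoc (α := fun _ => MSMT.MultiIdx N) γ (pσ.2 - ∑ k, γ k)) :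
        ℕ × (Fin (m + 1) → MSMT.MultiIdx N)) := by
    intro pσ γ γ' h
    have := congrArg (fun x => Fin.init x.2) h
    simpa using this
  convert! MSMT.hasSum_finset_fiberwise (MSMT.hasSum_tupleCoeff X (m + 1))
    (fun x => (x.1, ∑ k, x.2 k))
    (fun pσ => (MSMT.nestedRange m pσ.2).map ⟨_, hinj pσ⟩) ?_ using 1
  · funext ⟨p, σ⟩
    rw [MSMT.sum_solidHarmonic_self, sum_map]
    simp only [Function.Embedding.coeFn_mk]
    have : ∀ γ ∈ MSMT.nestedRange m σ,
        ∑ k, Fin.snoc (α := fun _ => MSMT.MultiIdx N) γ (σ - ∑ k, γ k) k = σ := by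
      intro γ hγ
      rw [Fin.sum_univ_castSucc]
      simpa using add_tsub_cancel_of_le ((MSMT.mem_nestedRange_iff_sum_le m σ γ).mp hγ)
    rw [sum_congr rfl fun γ hγ => by rw [this γ hγ], ← sum_smul, MSMT.sum_tupleCoeff, mul_smul]
    congr 1
    ext n
    rw [PowerSeries.coeff_smul, PowerSeries.coeff_mul_C, PowerSeries.coeff_mul_C,
      mul_smul_comm]
  · rintro ⟨p, σ⟩ ⟨q, g⟩
    simp only [mem_map, MSMT.mem_nestedRange_iff_sum_le, Function.Embedding.coeFn_mk, Prod.mk.injEq]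
    constructor
    · rintro ⟨γ, hγ, rfl, rfl⟩
      refine ⟨rfl, ?_⟩
      rw [Fin.sum_univ_castSucc]
      simpa using add_tsub_cancel_of_le hγ
    · rintro ⟨rfl, rfl⟩
      refine ⟨Fin.init g, ?_, rfl, ?_⟩
      · rw [Fin.sum_univ_castSucc]
        exact le_self_add
      · rw [Fin.sum_univ_castSucc]
        simp [Fin.init]
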